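/- For a vector $z\in\mathbb{R}^n$ write $z(i)$ for its $i$th entry, $\|z\|_0$ for the number of its nonzero entries and $\|z\|_1=\sum_i|z(i)|$. There exist universal constants $c,\tilde\gamma_1,\tilde\gamma_2>0$ and $N$ such that the following holds for all integers $n\ge N$ and all integers $k$ with $1\le k\le n/32$. Let $v\in\mathbb{R}^n$ be a fixed nonzero vector with $$\|v\|_0\le c\,\frac{n/\sqrt{\log n}}{\sqrt k},$$ let $i^*\in\arg\max_i|v(i)|$, let $\tilde v_1,\dots,\tilde v_k$ be independent $N(0,I_n)$ random vectors, and let $W=\mathrm{span}\{v,\tilde v_1,\dots,\tilde v_k\}$. Then, with probability at least $$1-\tilde\gamma_1e^{-\tilde\gamma_2n/2}-k\,e^{-\lfloor c\sqrt{n/\log n}\rfloor}-\frac{k}{n^2},$$ the vector $v/v(i^*)$ is the unique minimizer of $$\min\|z\|_1\quad\text{such that}\quad z\in W,\ z(i^*)=1.$$ -/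

import Mathlib

open MeasureTheory ProbabilityTheory
open scoped BigOperators

/-- The `ℓ₁` norm of a vector of `ℝⁿ`. -/
noncomputable def l1Norm {n : ℕ} (z : EuclideanSpace ℝ (Fin n)) : ℝ := ∑ i, |z i|

/-- The number `‖z‖₀` of nonzero entries of a vector of `ℝⁿ`. -/
noncomputable def l0Norm {n : ℕ} (z : EuclideanSpace ℝ (Fin n)) : ℕ := {i : Fin n | z i ≠ 0}.ncard

/-- The subspace spanned by `v` and the vectors `u 0, …, u (k - 1)`. -/
def plantedSubspace {n k : ℕ} (v : EuclideanSpace ℝ (Fin n))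
    (u : Fin k → EuclideanSpace ℝ (Fin n)) : Submodule ℝ (EuclideanSpace ℝ (Fin n)) :=
  Submodule.span ℝ ({v} ∪ Set.range u)

/-- `z` is a minimizer of the program: minimize `‖z‖₁` subject to `z ∈ W`, `z i = 1`. -/
def IsMinimizer {n : ℕ} (W : Submodule ℝ (EuclideanSpace ℝ (Fin n))) (i : Fin n)
    (z : EuclideanSpace ℝ (Fin n)) : Prop :=
  (z ∈ W ∧ z i = 1) ∧ ∀ y ∈ W, y i = 1 → l1Norm z ≤ l1Norm y

/-- `z` is the unique minimizer of the program: minimize `‖z‖₁` subject to `z ∈ W`, `z i = 1`. -/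
def IsUniqueMinimizer {n : ℕ} (W : Submodule ℝ (EuclideanSpace ℝ (Fin n))) (i : Fin n)
    (z : EuclideanSpace ℝ (Fin n)) : Prop :=
  IsMinimizer W i z ∧ ∀ y, IsMinimizer W i y → y = z

/-! A feasible point has the form `a • v + z` with `z = ∑ j, b j • u j`, and the constraint at `i*`
determines `a` from `z i*`. Compared with `v / v i*`, its `ℓ₁` norm gains the mass of `z` off the
support `S` of `v` and loses at most `∑_S |z| + ‖v‖₀ |z i*|`. So it suffices that `2 ∑_S |z| + ‖v‖₀
|z i*| < ‖z‖₁` for every `b ≠ 0` (`isUniqueMinimizer_of_l1Norm_lt`).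

With `κ = exp (-3) / 2`, Chernoff bounds on a net of the coefficient sphere give `‖z‖₁ ≥ κ n ‖b‖`
for all `b` at once (`exists_event_l1Norm_lower_bound`). The left side needs no net: bounds on `∑_S
|u j|` and `|u j i*|` for each single `j` pass to all combinations at the cost of a factor `√k`
(`sum_abs_sum_smul_le`). The sparsity of `v` makes the resulting terms small against `κ n ‖b‖`. -/

/-- A lower bound on the `ℓ₁` norms in the span of the random directions forces `v / v i₀` to be
the unique minimizer. -/
lemma isUniqueMinimizer_of_l1Norm_lt {n k : ℕ} {v : EuclideanSpace ℝ (Fin n)} (hv : v ≠ 0)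
    {i₀ : Fin n} (hmax : ∀ i, |v i| ≤ |v i₀|) (u : Fin k → EuclideanSpace ℝ (Fin n))
    (h : ∀ b : Fin k → ℝ, b ≠ 0 →
      2 * (∑ i with v i ≠ 0, |(∑ j, b j • u j) i|) + l0Norm v * |(∑ j, b j • u j) i₀|
        < l1Norm (∑ j, b j • u j)) :
    IsUniqueMinimizer (plantedSubspace v u) i₀ ((v i₀)⁻¹ • v) := by
  have hv0 : v i₀ ≠ 0 := by
    intro h0
    apply hv
    ext i
    have := hmax i
    rw [h0, abs_zero] at this
    simpa using this
  have hcard : (l0Norm v : ℝ) = ((Finset.univ.filter fun i => v i ≠ 0).card : ℝ) := by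
    unfold l0Norm
    rw [Set.ncard_eq_toFinset_card']
    simp
  have key : ∀ y ∈ plantedSubspace v u, y i₀ = 1 →
      y = (v i₀)⁻¹ • v ∨ l1Norm ((v i₀)⁻¹ • v) < l1Norm y := by
    intro y hy hy1
    unfold plantedSubspace at hy
    rw [Set.singleton_union, Submodule.mem_span_insert] at hy
    obtain ⟨a, w, hw, rfl⟩ := hy
    obtain ⟨b, rfl⟩ := (Submodule.mem_span_range_iff_exists_fun ℝ).1 hw
    by_cases hb : b = 0
    · left
      subst hb
      simp only [Pi.zero_apply, zero_smul, Finset.sum_const_zero, add_zero, PiLp.smul_apply,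
        smul_eq_mul] at hy1 ⊢
      rw [eq_inv_of_mul_eq_one_left hy1]
    · right
      specialize h b hb
      set z := ∑ j, b j • u j with hz
      simp only [PiLp.add_apply, PiLp.smul_apply, smul_eq_mul] at hy1
      -- On the support, `a * v i = s - z i₀ * s` with `s = v i / v i₀` and `|s| ≤ 1`, so replacing
      -- `s` by the entry of `y` costs at most `|z i₀| + |z i|`.
      have hterm : ∀ i, (if v i ≠ 0 then |(v i₀)⁻¹ * v i| - |z i₀| - |z i| else |z i|)
          ≤ |a * v i + z i| := by
        intro i
        split_ifs with hi
        · have ha : a = (1 - z i₀) * (v i₀)⁻¹ := by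
            field_simp
            linarith
          set s := (v i₀)⁻¹ * v i with hs
          have hs1 : |s| ≤ 1 := by
            rw [hs, abs_mul, abs_inv, inv_mul_le_one₀ (abs_pos.2 hv0)]
            exact hmax i
          have e : a * v i + z i = s - z i₀ * s + z i := by rw [ha, hs]; ring
          rw [e]
          have h1 : |s| ≤ |s - z i₀ * s + z i| + |z i₀ * s| + |z i| := by
            calc |s| = |(s - z i₀ * s + z i) + z i₀ * s - z i| := by ring_nf
              _ ≤ |(s - z i₀ * s + z i) + z i₀ * s| + |z i| := abs_sub _ _
              _ ≤ _ := by gcongr; exact abs_add_le _ _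
          have h2 : |z i₀ * s| ≤ |z i₀| := by
            rw [abs_mul]
            exact mul_le_of_le_one_right (abs_nonneg _) hs1
          linarith
        · rw [not_not.1 hi]
          simp
      have hsum := Finset.sum_le_sum fun i (_ : i ∈ Finset.univ) => hterm i
      rw [Finset.sum_ite, Finset.sum_sub_distrib, Finset.sum_sub_distrib, Finset.sum_const,
        nsmul_eq_mul, ← hcard] at hsum
      have hs : l1Norm ((v i₀)⁻¹ • v) = ∑ i with v i ≠ 0, |(v i₀)⁻¹ * v i| := by
        unfold l1Norm
        have h0 : ∑ i with ¬ v i ≠ 0, |((v i₀)⁻¹ • v) i| = 0 := by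
          refine Finset.sum_eq_zero fun i hi => ?_
          have : v i = 0 := by simpa using hi
          simp [this]
        rw [← Finset.sum_filter_add_sum_filter_not _ (fun i => v i ≠ 0), h0, add_zero]
        rfl
      have hzs : l1Norm z = ∑ i with v i ≠ 0, |z i| + ∑ i with ¬ v i ≠ 0, |z i| := by
        unfold l1Norm
        rw [Finset.sum_filter_add_sum_filter_not]
      have hy : l1Norm (a • v + z) = ∑ i, |a * v i + z i| := rfl
      rw [hs, hy]
      linarith
  have hfeas : (v i₀)⁻¹ • v ∈ plantedSubspace v u ∧ ((v i₀)⁻¹ • v) i₀ = 1 :=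
    ⟨Submodule.smul_mem _ _ (Submodule.subset_span (by simp)), by simp [hv0]⟩
  refine ⟨⟨hfeas, fun y hy hy1 => ?_⟩, fun y hy => ?_⟩
  · rcases key y hy hy1 with rfl | h
    exacts [le_rfl, h.le]
  · rcases key y hy.1.1 hy.1.2 with h | h
    exacts [h, absurd (hy.2 _ hfeas.1 hfeas.2) (not_le.2 h)]

/-! ### Nets of the unit sphere -/

section Net

open Metric Module

variable {E : Type*} [NormedAddCommGroup E] [NormedSpace ℝ E]

/-- A finite `ε`-separated set in the unit ball has at most `(1 + 2 / ε) ^ dim` elements. -/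
lemma card_le_of_separated_of_norm_le_one [FiniteDimensional ℝ E] {ε : ℝ} (hε : 0 < ε)
    (s : Finset E)
    (hs : ∀ c ∈ s, ‖c‖ ≤ 1) (h : ∀ c ∈ s, ∀ d ∈ s, c ≠ d → ε ≤ ‖c - d‖) :
    (s.card : ℝ) ≤ (1 + 2 / ε) ^ finrank ℝ E := by
  borelize E
  let μ : Measure E := Measure.addHaar
  have δpos : 0 < ε / 2 := by positivity
  have ρpos : 0 < 1 + ε / 2 := by positivity
  -- Volume comparison: the balls of radius `ε / 2` about the points are disjoint and lie in the
  -- ball of radius `1 + ε / 2`.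
  set A := ⋃ c ∈ s, ball (c : E) (ε / 2) with hA
  have D : Set.Pairwise (s : Set E) (Function.onFun Disjoint fun c => ball (c : E) (ε / 2)) := by
    rintro c hc d hd hcd
    apply ball_disjoint_ball
    rw [dist_eq_norm, add_halves]
    exact h c hc d hd hcd
  have A_subset : A ⊆ ball (0 : E) (1 + ε / 2) := by
    refine Set.iUnion₂_subset fun x hx => ball_subset_ball' ?_
    rw [dist_zero_right, add_comm]
    gcongr
    exact hs x hx
  have I : (s.card : ENNReal) * ENNReal.ofReal ((ε / 2) ^ finrank ℝ E) * μ (ball 0 1) ≤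
      ENNReal.ofReal ((1 + ε / 2) ^ finrank ℝ E) * μ (ball 0 1) :=
    calc
      _ = μ A := by
        rw [hA, measure_biUnion_finset D fun c _ => measurableSet_ball]
        simp only [μ.addHaar_ball_of_pos _ δpos]
        simp only [Finset.sum_const, nsmul_eq_mul, mul_assoc]
      _ ≤ μ (ball (0 : E) (1 + ε / 2)) := measure_mono A_subset
      _ = _ := by simp only [μ.addHaar_ball_of_pos _ ρpos]
  have J := (ENNReal.mul_le_mul_iff_left (measure_ball_pos μ _ zero_lt_one).ne'
    measure_ball_lt_top.ne).1 I
  have K := ENNReal.toReal_le_of_le_ofReal (pow_nonneg ρpos.le _) J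
  rw [ENNReal.toReal_mul, ENNReal.toReal_natCast, ENNReal.toReal_ofReal (by positivity)] at K
  have e : 1 + 2 / ε = (1 + ε / 2) / (ε / 2) := by field_simp; ring
  rw [e, div_pow, le_div_iff₀ (by positivity)]
  exact K

/-- The unit sphere has an `ε`-net with at most `(1 + 2 / ε) ^ dim` elements. -/
lemma exists_finset_net_sphere (E : Type*) [NormedAddCommGroup E] [NormedSpace ℝ E]
    [FiniteDimensional ℝ E] {ε : ℝ} (hε : 0 < ε) :
    ∃ s : Finset E, (∀ p ∈ s, ‖p‖ = 1) ∧ (∀ x : E, ‖x‖ = 1 → ∃ p ∈ s, ‖x - p‖ ≤ ε) ∧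
      (s.card : ℝ) ≤ (1 + 2 / ε) ^ finrank ℝ E := by
  classical
  -- A separated set of maximal cardinality is a net, since an uncovered point could be added to it.
  -- The volume bound ensures that a maximum exists.
  let Q : ℕ → Prop := fun m => ∃ s : Finset E, s.card = m ∧ (∀ p ∈ s, ‖p‖ = 1) ∧
    ∀ c ∈ s, ∀ d ∈ s, c ≠ d → ε ≤ ‖c - d‖
  have hbound : ∀ m, Q m → m ≤ ⌊(1 + 2 / ε) ^ finrank ℝ E⌋₊ := by
    rintro m ⟨s, rfl, hs, hsep⟩
    exact Nat.le_floor (card_le_of_separated_of_norm_le_one hε s (fun c hc => (hs c hc).le) hsep)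
  have hQ0 : Q 0 := ⟨∅, by simp⟩
  obtain ⟨s, hcard, hs, hsep⟩ := Nat.findGreatest_spec (P := Q)
    (Nat.zero_le ⌊(1 + 2 / ε) ^ finrank ℝ E⌋₊) hQ0
  refine ⟨s, hs, fun x hx => ?_,
    card_le_of_separated_of_norm_le_one hε s (fun c hc => (hs c hc).le) hsep⟩
  by_contra! hcon
  have hxs : x ∉ s := fun hxs => by simpa [hε.not_gt] using hcon x hxs
  have hQ : Q (insert x s).card := by
    refine ⟨_, rfl, ?_, ?_⟩
    · simpa [hx] using hs
    · intro c hc d hd hcd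
      rcases Finset.mem_insert.1 hc with rfl | hc' <;>
        rcases Finset.mem_insert.1 hd with rfl | hd'
      · exact absurd rfl hcd
      · exact (hcon d hd').le
      · rw [norm_sub_rev]
        exact (hcon c hc').le
      · exact hsep c hc' d hd' hcd
  have := Nat.le_findGreatest (hbound _ hQ) hQ
  rw [Finset.card_insert_of_notMem hxs, hcard] at this
  omega

/-- Two-sided bounds for an operator on an `ε`-net give a lower bound everywhere. -/
lemma le_norm_apply_of_net {F : Type*} [NormedAddCommGroup F] [NormedSpace ℝ F] (T : E →L[ℝ] F)
    {s : Finset E} {ε δ M : ℝ} (hM : 0 ≤ M) (hε0 : 0 ≤ ε) (hε : ε ≤ 1 / 2)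
    (hnet : ∀ x : E, ‖x‖ = 1 → ∃ p ∈ s, ‖x - p‖ ≤ ε) (hup : ∀ p ∈ s, ‖T p‖ ≤ M)
    (hlo : ∀ p ∈ s, δ ≤ ‖T p‖) (x : E) : (δ - 2 * M * ε) * ‖x‖ ≤ ‖T x‖ := by
  have happ : ∀ y p : E, ‖y - p‖ ≤ ε → ‖T y - T p‖ ≤ ‖T‖ * ε := fun y p h => by
    rw [← map_sub]
    exact (T.le_opNorm _).trans (by gcongr)
  -- Approximation by the net bounds `‖T‖` by `M + ‖T‖ * ε`, and `ε ≤ 1 / 2` lets the last term be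
  -- absorbed.
  have hT : ‖T‖ ≤ 2 * M := by
    have : ‖T‖ ≤ M + ‖T‖ * ε := by
      refine T.opNorm_le_of_unit_norm (by positivity) fun y hy => ?_
      obtain ⟨p, hp, hyp⟩ := hnet y hy
      have h1 := norm_le_norm_add_norm_sub' (T y) (T p)
      have h2 := happ y p hyp
      have h3 := hup p hp
      linarith
    nlinarith [norm_nonneg T]
  have hunit : ∀ y : E, ‖y‖ = 1 → δ - 2 * M * ε ≤ ‖T y‖ := fun y hy => by
    obtain ⟨p, hp, hyp⟩ := hnet y hy
    have h1 := norm_le_norm_add_norm_sub (T y) (T p)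
    have h2 := happ y p hyp
    have h3 := hlo p hp
    have h4 : ‖T‖ * ε ≤ 2 * M * ε := by gcongr
    linarith
  rcases eq_or_ne x 0 with rfl | hx
  · simp
  · have hx' : 0 < ‖x‖ := norm_pos_iff.2 hx
    have := hunit (‖x‖⁻¹ • x) (by rw [norm_smul, norm_inv, norm_norm, inv_mul_cancel₀ hx'.ne'])
    rw [map_smul, norm_smul, norm_inv, norm_norm, inv_mul_eq_div, le_div_iff₀ hx'] at this
    exact this

end Net

/-! ### Chernoff bounds for `ℓ₁` norms of Gaussian vectors -/

section Tails

lemma integrable_exp_mul_abs_gaussianReal (l : ℝ) :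
    Integrable (fun x => Real.exp (l * |x|)) (gaussianReal 0 1) := by
  refine ((integrable_exp_mul_gaussianReal l).add (integrable_exp_mul_gaussianReal (-l))).mono'
    (by fun_prop) (Filter.Eventually.of_forall fun x => ?_)
  rw [Real.norm_eq_abs, Real.abs_exp, Pi.add_apply]
  rcases abs_cases x with h | h <;> rw [h.1]
  · linarith [Real.exp_pos (-l * x)]
  · rw [mul_neg, ← neg_mul]
    linarith [Real.exp_pos (l * x)]

lemma mgf_abs_gaussianReal_le (l : ℝ) :
    mgf (fun x => |x|) (gaussianReal 0 1) l ≤ 2 * Real.exp (l ^ 2 / 2) := by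
  have hm : ∀ t : ℝ, ∫ x, Real.exp (t * x) ∂(gaussianReal 0 1) = Real.exp (t ^ 2 / 2) := fun t => by
    have := mgf_gaussianReal (p := gaussianReal 0 1) (X := id)
      (μ := 0) (v := 1) Measure.map_id t
    simpa [mgf] using this
  calc mgf (fun x => |x|) (gaussianReal 0 1) l
      ≤ ∫ x, (Real.exp (l * x) + Real.exp (-l * x)) ∂(gaussianReal 0 1) := by
        refine integral_mono (integrable_exp_mul_abs_gaussianReal l)
          ((integrable_exp_mul_gaussianReal l).add (integrable_exp_mul_gaussianReal (-l)))
          fun x => ?_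
        dsimp only
        rcases abs_cases x with h | h <;> rw [h.1]
        · linarith [Real.exp_pos (-l * x)]
        · rw [mul_neg, ← neg_mul]
          linarith [Real.exp_pos (l * x)]
    _ = 2 * Real.exp (l ^ 2 / 2) := by
        rw [integral_add (integrable_exp_mul_gaussianReal l) (integrable_exp_mul_gaussianReal (-l)),
          hm, hm, neg_sq, two_mul]

/-- The Gaussian density is at most `1 / 2`, and `exp (-l * |x|)` has Lebesgue integral `2 / l`. The
decay in `l` makes very small values of the `ℓ₁` norm exponentially unlikely. -/
lemma mgf_abs_gaussianReal_neg_le {l : ℝ} (hl : 0 < l) :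
    mgf (fun x => |x|) (gaussianReal 0 1) (-l) ≤ 1 / l := by
  have hval : ∫ x : ℝ, Real.exp (-l * |x|) = 2 / l := by
    rw [integral_comp_abs (f := fun x => Real.exp (-l * x)), integral_exp_mul_Ioi (by linarith)]
    simp
    ring
  have hint : Integrable (fun x : ℝ => Real.exp (-l * |x|)) :=
    Integrable.of_integral_ne_zero (by rw [hval]; positivity)
  have hpdf : ∀ x, gaussianPDFReal 0 1 x ≤ 1 / 2 := fun x => by
    rw [gaussianPDFReal]
    have h1 : (√(2 * Real.pi * ((1 : NNReal) : ℝ)))⁻¹ ≤ 1 / 2 := by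
      rw [one_div]
      apply inv_anti₀ (by norm_num)
      apply Real.le_sqrt_of_sq_le
      have := Real.pi_gt_three
      norm_num
      linarith
    have h2 : Real.exp (-(x - 0) ^ 2 / (2 * ((1 : NNReal) : ℝ))) ≤ 1 := by
      rw [Real.exp_le_one_iff]
      norm_num
      nlinarith [sq_nonneg x]
    calc _ ≤ 1 / 2 * (1 : ℝ) := by gcongr
      _ = _ := by ring
  rw [mgf, integral_gaussianReal_eq_integral_smul one_ne_zero]
  calc ∫ x, gaussianPDFReal 0 1 x • Real.exp (-l * |x|)
      ≤ ∫ x, 1 / 2 * Real.exp (-l * |x|) := by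
        refine integral_mono_of_nonneg (Filter.Eventually.of_forall fun x => ?_)
          (hint.const_mul _) (Filter.Eventually.of_forall fun x => ?_)
        · exact mul_nonneg (gaussianPDFReal_nonneg _ _ _) (Real.exp_pos _).le
        · exact mul_le_mul_of_nonneg_right (hpdf x) (Real.exp_pos _).le
    _ = 1 / l := by
        rw [integral_const_mul, hval]
        ring

variable {ι : Type*} [Fintype ι]

lemma iIndepFun_abs_pi_gaussianReal :
    iIndepFun (fun (i : ι) (x : ι → ℝ) => |x i|) (Measure.pi fun _ : ι => gaussianReal 0 1) :=
  iIndepFun_pi (X := fun _ (x : ℝ) => |x|) fun _ => by fun_prop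

lemma mgf_sum_abs_pi_gaussianReal (s : Finset ι) (l : ℝ) :
    mgf (∑ i ∈ s, fun x : ι → ℝ => |x i|) (Measure.pi fun _ : ι => gaussianReal 0 1) l
      = mgf (fun x => |x|) (gaussianReal 0 1) l ^ s.card := by
  rw [iIndepFun_abs_pi_gaussianReal.mgf_sum (fun i => by fun_prop) s]
  refine Finset.prod_eq_pow_card fun i _ => ?_
  exact integral_comp_eval (μ := fun _ : ι => gaussianReal 0 1) (i := i)
    (f := fun y : ℝ => Real.exp (l * |y|)) (by fun_prop)

lemma integrable_exp_mul_sum_abs_pi_gaussianReal (s : Finset ι) (l : ℝ) :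
    Integrable (fun x => Real.exp (l * (∑ i ∈ s, fun x : ι → ℝ => |x i|) x))
      (Measure.pi fun _ : ι => gaussianReal 0 1) :=
  iIndepFun_abs_pi_gaussianReal.integrable_exp_mul_sum (fun i => by fun_prop) fun i _ =>
    integrable_comp_eval (μ := fun _ : ι => gaussianReal 0 1) (i := i)
      (f := fun y : ℝ => Real.exp (l * |y|)) (integrable_exp_mul_abs_gaussianReal l)

lemma stdGaussian_real_eq_pi {s : Set (EuclideanSpace ℝ ι)} (hs : MeasurableSet s) :
    (stdGaussian (EuclideanSpace ℝ ι)).real s =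
      (Measure.pi fun _ : ι => gaussianReal 0 1).real (WithLp.toLp 2 ⁻¹' s) := by
  rw [← map_pi_eq_stdGaussian, map_measureReal_apply (by fun_prop) hs]

lemma stdGaussian_le_sum_abs (s : Finset ι) {l : ℝ} (hl : 0 ≤ l) (t : ℝ) :
    (stdGaussian (EuclideanSpace ℝ ι)).real {x | t ≤ ∑ i ∈ s, |x i|}
      ≤ Real.exp (-l * t) * (2 * Real.exp (l ^ 2 / 2)) ^ s.card := by
  rw [stdGaussian_real_eq_pi (measurableSet_le (by fun_prop) (by fun_prop))]
  have h := measure_ge_le_exp_mul_mgf t hl (integrable_exp_mul_sum_abs_pi_gaussianReal s l)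
  rw [mgf_sum_abs_pi_gaussianReal] at h
  simp only [Finset.sum_apply] at h
  refine h.trans ?_
  gcongr
  · exact mgf_nonneg
  · exact mgf_abs_gaussianReal_le l

lemma stdGaussian_sum_abs_le {l : ℝ} (hl : 0 < l) (t : ℝ) :
    (stdGaussian (EuclideanSpace ℝ ι)).real {x | ∑ i, |x i| ≤ t}
      ≤ Real.exp (l * t) * (1 / l) ^ Fintype.card ι := by
  rw [stdGaussian_real_eq_pi (measurableSet_le (by fun_prop) (by fun_prop))]
  have h := measure_le_le_exp_mul_mgf t (neg_nonpos.2 hl.le)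
    (integrable_exp_mul_sum_abs_pi_gaussianReal (Finset.univ : Finset ι) (-l))
  rw [mgf_sum_abs_pi_gaussianReal, neg_neg] at h
  simp only [Finset.sum_apply] at h
  refine h.trans ?_
  rw [Finset.card_univ]
  gcongr
  · exact mgf_nonneg
  · exact mgf_abs_gaussianReal_neg_le hl

/-- A linear combination, with unit coefficient vector, of independent standard Gaussian vectors is
a standard Gaussian vector. -/
lemma hasLaw_sum_smul_stdGaussian {κ Ω : Type*} [Fintype κ] [MeasurableSpace Ω] {P : Measure Ω}
    [IsProbabilityMeasure P] {u : κ → Ω → EuclideanSpace ℝ ι}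
    (hu : ∀ j, HasLaw (u j) (stdGaussian (EuclideanSpace ℝ ι)) P) (hind : iIndepFun u P)
    {b : EuclideanSpace ℝ κ} (hb : ‖b‖ = 1) :
    HasLaw (fun ω => ∑ j, b j • u j ω) (stdGaussian (EuclideanSpace ℝ ι)) P := by
  have hm : ∀ j, AEMeasurable (fun ω => b j • u j ω) P :=
    fun j => (hu j).aemeasurable.const_smul (b j)
  have hmsum : AEMeasurable (fun ω => ∑ j, b j • u j ω) P :=
    Finset.aemeasurable_fun_sum _ fun j _ => hm j
  refine ⟨hmsum, ?_⟩
  have : IsProbabilityMeasure (P.map fun ω => ∑ j, b j • u j ω) :=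
    Measure.isProbabilityMeasure_map hmsum
  have hind' : iIndepFun (fun j ω => b j • u j ω) P :=
    hind.comp (fun j x => b j • x) fun j => by fun_prop
  -- The characteristic functions multiply to `exp (-(∑ j, b j ^ 2) * ‖t‖ ^ 2 / 2)`, and the sum of
  -- squares is `1`.
  apply Measure.ext_of_charFun
  rw [hind'.charFun_map_fun_sum_eq_prod hm]
  ext t
  have hj : ∀ j, charFun (P.map fun ω => b j • u j ω) t
      = Complex.exp (-((b j) ^ 2 * ‖t‖ ^ 2 / 2 : ℝ)) := fun j => by
    have e : (P.map fun ω => b j • u j ω) = (P.map (u j)).map (b j • ·) := by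
      rw [AEMeasurable.map_map_of_aemeasurable (by fun_prop) (hu j).aemeasurable]
      rfl
    rw [e, charFun_map_smul, (hu j).map_eq, charFun_stdGaussian, norm_smul]
    congr 1
    rw [Real.norm_eq_abs]
    push_cast
    rw [mul_pow, ← Complex.ofReal_pow, sq_abs]
    push_cast
    ring
  rw [Finset.prod_apply, charFun_stdGaussian]
  simp_rw [hj]
  rw [← Complex.exp_sum]
  congr 1
  rw [Finset.sum_neg_distrib, ← Complex.ofReal_sum, ← Finset.sum_div, ← Finset.sum_mul,
    ← EuclideanSpace.real_norm_sq_eq, hb]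
  push_cast
  ring

end Tails

/-! ### `ℓ₁` estimates on the span of the Gaussian vectors -/

/-- The map `b ↦ ∑ j, b j • u j` into `ℝⁿ` with the `ℓ₁` norm. -/
noncomputable def combinationL1 {n k : ℕ} (u : Fin k → EuclideanSpace ℝ (Fin n)) :
    EuclideanSpace ℝ (Fin k) →L[ℝ] PiLp 1 (fun _ : Fin n => ℝ) :=
  LinearMap.toContinuousLinearMap
    { toFun := fun b => WithLp.toLp 1 (WithLp.ofLp (∑ j, b j • u j))
      map_add' := fun a b => by simp [add_smul, Finset.sum_add_distrib]
      map_smul' := fun a b => by simp [mul_smul, Finset.smul_sum] }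

lemma norm_combinationL1 {n k : ℕ} (u : Fin k → EuclideanSpace ℝ (Fin n))
    (b : EuclideanSpace ℝ (Fin k)) : ‖combinationL1 u b‖ = l1Norm (∑ j, b j • u j) := by
  rw [PiLp.norm_eq_of_L1]
  rfl

lemma measurable_l1Norm {n : ℕ} : Measurable (l1Norm (n := n)) := by
  unfold l1Norm
  fun_prop

section GaussianSpan

variable {n k : ℕ} {Ω : Type*} [MeasurableSpace Ω] {P : Measure Ω}
  {u : Fin k → Ω → EuclideanSpace ℝ (Fin n)}

/-- Outside an event of exponentially small probability, the `ℓ₁` norm dominates `n` times the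
Euclidean norm of the coefficients on the span of `k ≤ n / 32` independent Gaussian vectors. -/
lemma exists_event_l1Norm_lower_bound [IsProbabilityMeasure P] (hk : (k : ℝ) ≤ n / 32)
    (hu : ∀ j, HasLaw (u j) (stdGaussian (EuclideanSpace ℝ (Fin n))) P) (hind : iIndepFun u P) :
    ∃ B : Set Ω, P.real B ≤ 2 * Real.exp (-n) ∧ ∀ ω ∉ B, ∀ b : EuclideanSpace ℝ (Fin k),
      Real.exp (-3) / 2 * n * ‖b‖ ≤ l1Norm (∑ j, b j • u j ω) := by
  -- With `δ = exp (-3) * n` and `M = 3 * n`, this `ε` makes `δ - 2 * M * ε` equal to `δ / 2`.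
  have hε : 0 < Real.exp (-3) / 12 := by positivity
  have hle1 : Real.exp (-3) ≤ 1 := Real.exp_le_one_iff.2 (by norm_num)
  obtain ⟨s, hs, hnet, hcard⟩ := exists_finset_net_sphere (EuclideanSpace ℝ (Fin k)) hε
  -- The net has at most `exp (8 * k)` points, and `k ≤ n / 32`. Against tails of size `exp (-(5 /
  -- 4) * n)` this leaves `exp (-n)`.
  have hcard' : (s.card : ℝ) ≤ Real.exp (n / 4) := by
    refine hcard.trans ?_
    rw [finrank_euclideanSpace_fin]
    have h1 : 1 + 2 / (Real.exp (-3) / 12) ≤ Real.exp 8 := by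
      have e3 : (1 : ℝ) ≤ Real.exp 3 := Real.one_le_exp (by norm_num)
      have e5 : (25 : ℝ) ≤ Real.exp 5 := by
        have h2 : (2 : ℝ) ≤ Real.exp 1 := by linarith [Real.add_one_le_exp (1 : ℝ)]
        calc (25 : ℝ) ≤ 2 ^ 5 := by norm_num
          _ ≤ Real.exp 1 ^ 5 := by gcongr
          _ = Real.exp 5 := by rw [← Real.exp_nat_mul]; norm_num
      have e : 2 / (Real.exp (-3) / 12) = 24 * Real.exp 3 := by
        rw [Real.exp_neg]
        field_simp
        norm_num
      rw [e, show (8 : ℝ) = 5 + 3 by norm_num, Real.exp_add]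
      nlinarith
    calc _ ≤ Real.exp 8 ^ k := by gcongr
      _ = Real.exp (k * 8) := by rw [← Real.exp_nat_mul]
      _ ≤ _ := by
        apply Real.exp_le_exp.2
        linarith
  have htail : ∀ p ∈ s, P.real {ω | 3 * n ≤ l1Norm (∑ j, p j • u j ω)}
        + P.real {ω | l1Norm (∑ j, p j • u j ω) ≤ Real.exp (-3) * n}
        ≤ Real.exp (-(5 / 4) * n) + Real.exp (-(5 / 4) * n) := by
    intro p hp
    have hlaw := hasLaw_sum_smul_stdGaussian hu hind (hs p hp)
    have hup := hlaw.measure_eq (p := fun x => 3 * (n : ℝ) ≤ l1Norm x)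
      (measurableSet_le measurable_const measurable_l1Norm)
    have hlo := hlaw.measure_eq (p := fun x => l1Norm x ≤ Real.exp (-3) * (n : ℝ))
      (measurableSet_le measurable_l1Norm measurable_const)
    rw [measureReal_def, measureReal_def, hup, hlo]
    gcongr
    · refine (stdGaussian_le_sum_abs Finset.univ zero_le_one (3 * (n : ℝ))).trans ?_
      rw [Finset.card_univ, Fintype.card_fin]
      have h2 : 2 * Real.exp ((1 : ℝ) ^ 2 / 2) ≤ Real.exp (7 / 4) := by
        have h2' : (2 : ℝ) ≤ Real.exp (5 / 4) := by linarith [Real.add_one_le_exp (5 / 4 : ℝ)]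
        calc _ ≤ Real.exp (5 / 4) * Real.exp ((1 : ℝ) ^ 2 / 2) := by gcongr
          _ = _ := by rw [← Real.exp_add]; norm_num
      calc _ ≤ Real.exp (-1 * (3 * n)) * Real.exp (7 / 4) ^ n := by gcongr
        _ = _ := by
          rw [← Real.exp_nat_mul, ← Real.exp_add]
          ring_nf
    -- With `l = exp 3` the bound is `exp n * exp (-3 * n)`, which is more than enough.
    · refine (stdGaussian_sum_abs_le (Real.exp_pos 3) (Real.exp (-3) * (n : ℝ))).trans ?_
      rw [Fintype.card_fin, ← mul_assoc, ← Real.exp_add, one_div, ← Real.exp_neg,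
        ← Real.exp_nat_mul, ← Real.exp_add]
      apply Real.exp_le_exp.2
      norm_num
      linarith [(Nat.cast_nonneg n : (0 : ℝ) ≤ n)]
  refine ⟨⋃ p ∈ s, ({ω | 3 * n ≤ l1Norm (∑ j, p j • u j ω)} ∪
    {ω | l1Norm (∑ j, p j • u j ω) ≤ Real.exp (-3) * n}), ?_, fun ω hω b => ?_⟩
  · calc _ ≤ ∑ p ∈ s, P.real ({ω | 3 * n ≤ l1Norm (∑ j, p j • u j ω)} ∪
          {ω | l1Norm (∑ j, p j • u j ω) ≤ Real.exp (-3) * n}) := measureReal_biUnion_finset_le _ _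
      _ ≤ ∑ p ∈ s, (Real.exp (-(5 / 4) * n) + Real.exp (-(5 / 4) * n)) :=
          Finset.sum_le_sum fun p hp => (measureReal_union_le _ _).trans (htail p hp)
      _ = s.card * (2 * Real.exp (-(5 / 4) * n)) := by rw [Finset.sum_const, nsmul_eq_mul]; ring
      _ ≤ Real.exp (n / 4) * (2 * Real.exp (-(5 / 4) * n)) := by gcongr
      _ = 2 * Real.exp (-n) := by
          rw [mul_left_comm, ← Real.exp_add]
          ring_nf
  · simp only [Set.mem_iUnion, Set.mem_union, Set.mem_ofPred_eq, exists_prop, not_exists, not_and,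
      not_or, not_le] at hω
    have := le_norm_apply_of_net (combinationL1 fun j => u j ω) (s := s)
      (δ := Real.exp (-3) * n) (M := 3 * n) (by positivity) hε.le (by linarith) hnet
      (fun p hp => by rw [norm_combinationL1]; exact (hω p hp).1.le)
      (fun p hp => by rw [norm_combinationL1]; exact (hω p hp).2.le) b
    rw [norm_combinationL1] at this
    refine le_trans (le_of_eq ?_) this
    ring

lemma measureReal_le_sum_abs_le {j : Fin k}
    (hu : HasLaw (u j) (stdGaussian (EuclideanSpace ℝ (Fin n))) P) (s : Finset (Fin n))
    {l : ℝ} (hl : 0 ≤ l) (t : ℝ) :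
    P.real {ω | t ≤ ∑ i ∈ s, |u j ω i|}
      ≤ Real.exp (-l * t) * (2 * Real.exp (l ^ 2 / 2)) ^ s.card := by
  have := hu.measure_eq (p := fun x => t ≤ ∑ i ∈ s, |x i|)
    (measurableSet_le (by fun_prop) (by fun_prop))
  rw [measureReal_def, this]
  exact stdGaussian_le_sum_abs s hl t

end GaussianSpan

/-- Triangle inequality, then Cauchy–Schwarz in the form `∑ j, |b j| ≤ √k * ‖b‖`. -/
lemma sum_abs_sum_smul_le {n k : ℕ} (u : Fin k → EuclideanSpace ℝ (Fin n)) (s : Finset (Fin n))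
    {t : ℝ} (ht : 0 ≤ t) (hu : ∀ j, ∑ i ∈ s, |u j i| ≤ t) (b : EuclideanSpace ℝ (Fin k)) :
    ∑ i ∈ s, |(∑ j, b j • u j) i| ≤ t * √k * ‖b‖ := by
  have hb : ∑ j, |b j| ≤ √k * ‖b‖ := by
    rw [EuclideanSpace.norm_eq, ← Real.sqrt_mul (Nat.cast_nonneg k)]
    apply Real.le_sqrt_of_sq_le
    simpa using sq_sum_le_card_mul_sum_sq (s := (Finset.univ : Finset (Fin k)))
      (f := fun j => |b j|)
  calc ∑ i ∈ s, |(∑ j, b j • u j) i| ≤ ∑ i ∈ s, ∑ j, |b j| * |u j i| := by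
        gcongr with i hi
        have : (∑ j, b j • u j) i = ∑ j, b j * u j i := by simp
        rw [this]
        refine (Finset.abs_sum_le_sum_abs _ _).trans (le_of_eq ?_)
        simp [abs_mul]
    _ = ∑ j, |b j| * ∑ i ∈ s, |u j i| := by
        rw [Finset.sum_comm]
        simp_rw [Finset.mul_sum]
    _ ≤ ∑ j, |b j| * t := by
        gcongr with j
        exact hu j
    _ = t * ∑ j, |b j| := by rw [← Finset.sum_mul, mul_comm]
    _ ≤ t * (√k * ‖b‖) := by gcongr
    _ = _ := by ring

/-! ### Choice of constants and union bound -/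

theorem theorem1 :
    ∃ c γ₁ γ₂ : ℝ, 0 < c ∧ 0 < γ₁ ∧ 0 < γ₂ ∧ ∃ N : ℕ, ∀ n : ℕ, N ≤ n →
      ∀ k : ℕ, 1 ≤ k → (k : ℝ) ≤ (n : ℝ) / 32 →
      ∀ v : EuclideanSpace ℝ (Fin n), v ≠ 0 →
      ∀ istar : Fin n, (∀ i, |v i| ≤ |v istar|) →
      (l0Norm v : ℝ) ≤ c * (((n : ℝ) / √(Real.log n)) / √(k : ℝ)) →
      ∀ (Ω : Type*) [MeasurableSpace Ω] (P : Measure Ω) [IsProbabilityMeasure P]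
        (u : Fin k → Ω → EuclideanSpace ℝ (Fin n)),
        (∀ j, HasLaw (u j) (multivariateGaussian 0 1) P) → iIndepFun u P →
        ∃ E : Set Ω, MeasurableSet E ∧
          (∀ ω ∈ E, IsUniqueMinimizer (plantedSubspace v (fun j => u j ω)) istar
            ((v istar)⁻¹ • v)) ∧
          1 - γ₁ * Real.exp (-(γ₂ * n / 2))
            - k * Real.exp (-(⌊c * √((n : ℝ) / Real.log n)⌋ : ℝ))
            - (k : ℝ) / (n : ℝ) ^ 2 ≤ P.real E := by
  obtain ⟨κ, hκdef⟩ : ∃ κ : ℝ, κ = Real.exp (-3) / 2 := ⟨_, rfl⟩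
  have hκ : 0 < κ := by rw [hκdef]; positivity
  -- In units of `κ * n * ‖b‖`, the mass on the support contributes `2 / 8` and the entry at `istar`
  -- contributes `3 / 32`, together less than `1`. Taking `n ≥ 3` ensures `log n ≥ 1`.
  refine ⟨κ / 32, 2, 2, by positivity, two_pos, two_pos, 3, ?_⟩
  intro n hn k hk1 hkn v hv istar hmax hsparse Ω _ P _ u hu hind
  simp only [multivariateGaussian_zero_one] at hu
  have hn3 : (3 : ℝ) ≤ n := by exact_mod_cast hn
  have hn0 : (0 : ℝ) < n := by linarith
  have hk1' : (1 : ℝ) ≤ k := by exact_mod_cast hk1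
  have hL1 : 1 ≤ Real.log n := by
    rw [Real.le_log_iff_exp_le hn0]
    linarith [Real.exp_one_lt_three]
  set L := Real.log n with hL
  set S : Finset (Fin n) := Finset.univ.filter fun i => v i ≠ 0 with hS
  have hcard : (l0Norm v : ℝ) = (S.card : ℝ) := by
    unfold l0Norm
    rw [Set.ncard_eq_toFinset_card']
    simp [hS]
  have hsk : 0 < √(k : ℝ) := by positivity
  have hsL : 1 ≤ √L := Real.one_le_sqrt.2 hL1
  have hm : (S.card : ℝ) * (√L * √k) ≤ κ / 32 * n := by
    rw [hcard, div_div, mul_div_assoc', le_div_iff₀ (by positivity)] at hsparse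
    exact hsparse
  set t := κ * n / (8 * √k) with ht
  have ht0 : 0 ≤ t := by positivity
  obtain ⟨B₁, hB₁, hlow⟩ := exists_event_l1Norm_lower_bound hkn hu hind
  rw [← hκdef] at hlow
  set B₂ : Fin k → Set Ω := fun j => {ω | t ≤ ∑ i ∈ S, |u j ω i|}
  set B₃ : Fin k → Set Ω := fun j => {ω | 3 * √L ≤ ∑ i ∈ {istar}, |u j ω i|}
  set B : Set Ω := B₁ ∪ (⋃ j, B₂ j) ∪ ⋃ j, B₃ j with hB
  -- The exponent is `-t + 2 * S.card`. Sparsity makes `2 * S.card` at most half of `t = κ / 8 * (n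
  -- / √k)`, and the remainder exceeds `κ / 32 * √(n / L)` because `k ≤ n`.
  have hB₂ : ∀ j, P.real (B₂ j) ≤ Real.exp (-(⌊κ / 32 * √((n : ℝ) / L)⌋ : ℝ)) := by
    intro j
    refine (measureReal_le_sum_abs_le (hu j) S zero_le_one t).trans ?_
    have h2 : 2 * Real.exp ((1 : ℝ) ^ 2 / 2) ≤ Real.exp 2 := by
      have h2' : (2 : ℝ) ≤ Real.exp (3 / 2) := by linarith [Real.add_one_le_exp (3 / 2 : ℝ)]
      calc _ ≤ Real.exp (3 / 2) * Real.exp ((1 : ℝ) ^ 2 / 2) := by gcongr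
        _ = _ := by rw [← Real.exp_add]; norm_num
    calc _ ≤ Real.exp (-1 * t) * Real.exp 2 ^ S.card := by gcongr
      _ = Real.exp (-1 * t + S.card * 2) := by rw [← Real.exp_nat_mul, ← Real.exp_add]
      _ ≤ _ := by
        apply Real.exp_le_exp.2
        have h1 : (⌊κ / 32 * √((n : ℝ) / L)⌋ : ℝ) ≤ κ / 32 * √((n : ℝ) / L) := Int.floor_le _
        have h3 : √((n : ℝ) / L) ≤ n / √k := by
          rw [le_div_iff₀ hsk, ← Real.sqrt_mul (by positivity)]
          apply Real.sqrt_le_iff.2 ⟨hn0.le, ?_⟩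
          rw [sq]
          gcongr
          · exact div_le_self hn0.le hL1
          · have : (k : ℝ) ≤ n := by linarith
            exact_mod_cast this
        have h4 : (S.card : ℝ) ≤ κ / 32 * (n / √k) := by
          rw [mul_div_assoc', le_div_iff₀ hsk]
          refine le_trans ?_ hm
          gcongr
          exact le_mul_of_one_le_left hsk.le hsL
        have h5 : t = κ / 8 * (n / √k) := by
          rw [ht]
          field_simp
        have h6 : κ / 32 * √((n : ℝ) / L) ≤ κ / 32 * (n / √k) := by gcongr
        linarith
  have hB₃ : ∀ j, P.real (B₃ j) ≤ 1 / (n : ℝ) ^ 2 := by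
    intro j
    -- Chernoff at `l = 3 * √L` gives the exponent `-9 / 2 * L`. Absorbing the factor `2` into `exp
    -- (5 / 2 * L)` leaves `-2 * L`, that is `1 / n ^ 2`.
    refine (measureReal_le_sum_abs_le (hu j) {istar} (l := 3 * √L) (by positivity) _).trans ?_
    have hsq : √L * √L = L := Real.mul_self_sqrt (by linarith)
    have h2 : (2 : ℝ) ≤ Real.exp (5 / 2 * L) := by linarith [Real.add_one_le_exp (5 / 2 * L)]
    have hn2 : (1 : ℝ) / n ^ 2 = Real.exp (-(2 * L)) := by
      rw [Real.exp_neg, two_mul, Real.exp_add, hL, Real.exp_log hn0, ← sq, one_div]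
    rw [hn2, Finset.card_singleton, pow_one]
    calc _ ≤ Real.exp (-(3 * √L) * (3 * √L))
          * (Real.exp (5 / 2 * L) * Real.exp ((3 * √L) ^ 2 / 2)) := by gcongr
      _ = _ := by
        rw [← Real.exp_add, ← Real.exp_add]
        congr 1
        linear_combination (-9 / 2 : ℝ) * hsq
  have hPB : P.real B ≤ 2 * Real.exp (-(2 * n / 2))
      + k * Real.exp (-(⌊κ / 32 * √((n : ℝ) / L)⌋ : ℝ)) + (k : ℝ) / (n : ℝ) ^ 2 := by
    have hU : ∀ (A : Fin k → Set Ω) (a : ℝ), (∀ j, P.real (A j) ≤ a) →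
        P.real (⋃ j, A j) ≤ k * a := fun A a hA => by
      refine (measureReal_iUnion_fintype_le A).trans ((Finset.sum_le_sum fun j _ => hA j).trans ?_)
      simp
    have e : (k : ℝ) / (n : ℝ) ^ 2 = k * (1 / (n : ℝ) ^ 2) := by ring
    rw [mul_div_cancel_left₀ _ (two_ne_zero' ℝ), e]
    exact (measureReal_union_le _ _).trans (add_le_add ((measureReal_union_le _ _).trans
      (add_le_add hB₁ (hU _ _ hB₂))) (hU _ _ hB₃))
  -- `B` need not be measurable, as the `u j` are only almost everywhere measurable. Its measurable
  -- hull has the same probability.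
  refine ⟨(toMeasurable P B)ᶜ, (measurableSet_toMeasurable P B).compl, fun ω hω => ?_, ?_⟩
  · have hωB : ω ∉ B := fun h => hω (subset_toMeasurable P B h)
    simp only [hB, Set.mem_union, Set.mem_iUnion, not_or, not_exists] at hωB
    obtain ⟨⟨hω₁, hω₂⟩, hω₃⟩ := hωB
    refine isUniqueMinimizer_of_l1Norm_lt hv hmax _ fun b hb => ?_
    set β : EuclideanSpace ℝ (Fin k) := WithLp.toLp 2 b with hβ
    have hβ0 : 0 < ‖β‖ := by
      rw [norm_pos_iff, hβ, Ne, WithLp.toLp_eq_zero]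
      exact hb
    have hlow' := hlow ω hω₁ β
    have h2 := sum_abs_sum_smul_le (fun j => u j ω) S ht0 (fun j => (not_le.1 (hω₂ j)).le) β
    have h3 := sum_abs_sum_smul_le (fun j => u j ω) {istar} (t := 3 * √L) (by positivity)
      (fun j => (not_le.1 (hω₃ j)).le) β
    rw [Finset.sum_singleton] at h3
    change 2 * (∑ i ∈ S, |(∑ j, β j • u j ω) i|) + l0Norm v * |(∑ j, β j • u j ω) istar| < _
    refine lt_of_lt_of_le ?_ hlow'
    have e2 : t * √k = κ / 8 * n := by
      rw [ht]
      field_simp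
    rw [e2] at h2
    have h3' : (l0Norm v : ℝ) * |(∑ j, β j • u j ω) istar| ≤ 3 * (κ / 32 * n) * ‖β‖ := by
      rw [hcard]
      calc _ ≤ (S.card : ℝ) * (3 * √L * √k * ‖β‖) := by gcongr
        _ = 3 * (S.card * (√L * √k)) * ‖β‖ := by ring
        _ ≤ _ := by gcongr
    have hpos : 0 < κ * n * ‖β‖ := by positivity
    nlinarith
  · have hE := probReal_compl_eq_one_sub (μ := P) (measurableSet_toMeasurable P B)
    have hT : P.real (toMeasurable P B) = P.real B := by
      rw [measureReal_def, measure_toMeasurable, measureReal_def]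
    rw [hE, hT]
    linarith
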